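/- **Definitions.** Let $P_1,\dots,P_N$ be players and let $\Gamma=\{\alpha_1,\dots,\alpha_r\}$ ($r\ge 1$) be an access structure, i.e. the family of all sets of players that are to be authorized; authorized sets are non-empty. $\Gamma$ is *monotone* if every set of players that contains a member of $\Gamma$ belongs to $\Gamma$. A *partial link classification* of $\Gamma$ is a partition of $\Gamma$ into classes such that any two members of the same class intersect, while any two distinct classes contain a pair of disjoint sets, one from each. Let $\lambda$ be the smallest number of classes in a partial link classification of $\Gamma$; equivalently, $\lambda$ is the minimum number of cliques into which the graph on $\Gamma$, whose edges join intersecting sets, can be partitioned. Fix a secret system of dimension $d\ge 2$. A *scheme* is a quantum channel (a completely positive trace-preserving map) that encodes the secret into finitely many finite-dimensional quantum shares, each of which is given to a player or kept by the dealer as a *home share*. A set of shares *can recover the secret* if some channel maps its reduced state back to the secret state, for every secret state; it *has no information* if its reduced state is the same for all secret states. An *assisted quantum secret sharing (AQSS) scheme* for $\Gamma$ is a scheme, not all of whose shares are home shares, such that for every set $A$ of players the shares of $A$ together with all home shares can recover the secret if $A\in\Gamma$, and have no information if $A\notin\Gamma$. It is *conventional* if it has no home shares. A $((k,n))$ *quantum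 threshold scheme* encodes the secret into $n$ shares such that any $k$ or more of them can recover the secret and any fewer than $k$ have no information. **Theorem.** For every $d\ge 2$ and every $\Gamma$ as above (its members may be mutually disjoint): 1. An AQSS scheme for $\Gamma$ exists if and only if $\Gamma$ is monotone. 2. If $\Gamma$ is monotone, there is an AQSS scheme for $\Gamma$ with at most $\lambda-1$ home shares. 3. More precisely, let $\Gamma$ be monotone and let $C_1,\dots,C_\lambda$ be any partial link classification of $\Gamma$ of the minimum size $\lambda$. Then there are a $((\lambda,2\lambda-1))$ quantum threshold scheme for the secret, an assignment of distinct shares of it to the classes, and for each $i$ a conventional quantum secret sharing scheme for the access structure $\{A : A\supseteq\alpha\text{ for some }\alpha\in C_i\}$ whose secret is the share assigned to $C_i$, such that the following is an AQSS scheme for $\Gamma$ with exactly $\lambda-1$ home shares: encode the secret by the threshold scheme, encode the share of each class $C_i$ by the scheme of that class, and keep each of the $\lambda-1$ remaining shares as one home share. -/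

import Mathlib

namespace AQSS

open scoped ComplexOrder

/-! ### States and channels on finite-dimensional quantum systems

A quantum system with orthonormal basis indexed by a finite type `n` has operators
`Matrix n n ℂ`. A composite system with factors `X i` has basis `∀ i, X i`. -/

/-- Density operators. -/
def IsDensity {n : Type} [Fintype n] (ρ : Matrix n n ℂ) : Prop :=
  ρ.PosSemidef ∧ ρ.trace = 1

/-- Quantum channels: completely positive (Kraus form) and trace preserving maps. -/
def IsChannel {n m : Type} [Fintype n] [Fintype m]
    (Φ : Matrix n n ℂ →ₗ[ℂ] Matrix m m ℂ) : Prop :=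
  (∃ (κ : Type) (_ : Fintype κ) (K : κ → Matrix m n ℂ),
      ∀ ρ, Φ ρ = ∑ k, K k * ρ * (K k).conjTranspose) ∧
    ∀ ρ, (Φ ρ).trace = ρ.trace

/-- The reduced operator on the factors in `S`: the partial trace over all other factors. -/
def reduced {ι : Type} [Fintype ι] [DecidableEq ι] {X : ι → Type} [∀ i, Fintype (X i)]
    (S : Finset ι) (ρ : Matrix (∀ i, X i) (∀ i, X i) ℂ) :
    Matrix (∀ i : {i // i ∈ S}, X i) (∀ i : {i // i ∈ S}, X i) ℂ :=
  Matrix.of fun a b => ∑ c : (∀ i : {i // i ∉ S}, X i),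
    ρ ((Equiv.piEquivPiSubtypeProd (· ∈ S) X).symm (a, c))
      ((Equiv.piEquivPiSubtypeProd (· ∈ S) X).symm (b, c))

/-- The tensor product of maps `Φ j`, the output factor `j` being itself a composite system
with factors `Y j s`; the output factors are indexed by the pairs `⟨j, s⟩`. It is determined by
its values on the matrix units `|x⟩⟨x'| = ⨂ j, |x j⟩⟨x' j|`. -/
def tensorMap {ι : Type} [Fintype ι] [DecidableEq ι] {X : ι → Type} [∀ j, Fintype (X j)]
    [∀ j, DecidableEq (X j)] {S : ι → Type} {Y : ∀ j, S j → Type}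
    (Φ : ∀ j, Matrix (X j) (X j) ℂ →ₗ[ℂ] Matrix (∀ s, Y j s) (∀ s, Y j s) ℂ) :
    Matrix (∀ j, X j) (∀ j, X j) ℂ →ₗ[ℂ]
      Matrix (∀ p : (Σ j, S j), Y p.1 p.2) (∀ p : (Σ j, S j), Y p.1 p.2) ℂ where
  toFun ρ := Matrix.of fun y y' => ∑ x, ∑ x', ρ x x' *
    ∏ j, Φ j (Matrix.single (x j) (x' j) 1) (fun s => y ⟨j, s⟩) (fun s => y' ⟨j, s⟩)
  map_add' ρ τ := by
    ext y y'
    simp [add_mul, Finset.sum_add_distrib]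
  map_smul' c ρ := by
    ext y y'
    simp [Finset.mul_sum, mul_assoc]

theorem tensorMap_apply {ι : Type} [Fintype ι] [DecidableEq ι] {X : ι → Type}
    [∀ j, Fintype (X j)] [∀ j, DecidableEq (X j)] {S : ι → Type} {Y : ∀ j, S j → Type}
    (Φ : ∀ j, Matrix (X j) (X j) ℂ →ₗ[ℂ] Matrix (∀ s, Y j s) (∀ s, Y j s) ℂ)
    (ρ : Matrix (∀ j, X j) (∀ j, X j) ℂ) (y y' : ∀ p : (Σ j, S j), Y p.1 p.2) :
    tensorMap Φ ρ y y' = ∑ x, ∑ x', ρ x x' *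
      ∏ j, Φ j (Matrix.single (x j) (x' j) 1) (fun s => y ⟨j, s⟩) (fun s => y' ⟨j, s⟩) :=
  rfl

theorem IsChannel.comp {n m l : Type} [Fintype n] [Fintype m] [Fintype l]
    {Ψ : Matrix m m ℂ →ₗ[ℂ] Matrix l l ℂ} {Φ : Matrix n n ℂ →ₗ[ℂ] Matrix m m ℂ}
    (hΨ : IsChannel Ψ) (hΦ : IsChannel Φ) : IsChannel (Ψ ∘ₗ Φ) := by
  obtain ⟨⟨κ, _, K, hK⟩, hT⟩ := hΨ
  obtain ⟨⟨κ', _, K', hK'⟩, hT'⟩ := hΦ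
  refine ⟨⟨κ × κ', inferInstance, fun k => K k.1 * K' k.2, fun ρ => ?_⟩, fun ρ => ?_⟩
  · simp [hK, hK', Fintype.sum_prod_type, Matrix.mul_sum, Matrix.sum_mul, Matrix.mul_assoc,
      Matrix.conjTranspose_mul]
  · simp [hT, hT']

theorem isChannel_tensorMap {ι : Type} [Fintype ι] [DecidableEq ι] {X : ι → Type}
    [∀ j, Fintype (X j)] [∀ j, DecidableEq (X j)] {S : ι → Type} [∀ j, Fintype (S j)]
    [∀ j, DecidableEq (S j)] {Y : ∀ j, S j → Type} [∀ j s, Fintype (Y j s)]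
    {Φ : ∀ j, Matrix (X j) (X j) ℂ →ₗ[ℂ] Matrix (∀ s, Y j s) (∀ s, Y j s) ℂ}
    (hΦ : ∀ j, IsChannel (Φ j)) : IsChannel (tensorMap Φ) := by
  constructor
  · choose κ hκ K hK using fun j => (hΦ j).1
    refine ⟨∀ j, κ j, inferInstance,
      fun k => Matrix.of fun y x => ∏ j, K j (k j) (fun s => y ⟨j, s⟩) (x j), fun ρ => ?_⟩
    ext y y'
    have h1 : ∀ (x x' : ∀ j, X j),
        ∏ j, Φ j (Matrix.single (x j) (x' j) 1) (fun s => y ⟨j, s⟩) (fun s => y' ⟨j, s⟩) =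
        ∑ k : (∀ j, κ j), ∏ j, (K j (k j) (fun s => y ⟨j, s⟩) (x j) *
          star (K j (k j) (fun s => y' ⟨j, s⟩) (x' j))) := by
      intro x x'
      rw [← Fintype.prod_sum (f := fun j k => K j k (fun s => y ⟨j, s⟩) (x j) *
        star (K j k (fun s => y' ⟨j, s⟩) (x' j)))]
      refine Finset.prod_congr rfl fun j _ => ?_
      rw [hK, Matrix.sum_apply]
      refine Finset.sum_congr rfl fun k _ => ?_
      simp [Matrix.mul_apply, Matrix.single_apply, ite_and]
    simp only [tensorMap_apply, h1, Matrix.sum_apply,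
      Matrix.mul_apply, Matrix.conjTranspose_apply, Matrix.of_apply, Finset.mul_sum,
      Finset.sum_mul, Finset.prod_mul_distrib, star_prod]
    rw [Finset.sum_comm]
    conv_lhs => enter [2, x']; rw [Finset.sum_comm]
    rw [Finset.sum_comm]
    refine Finset.sum_congr rfl fun k _ => Finset.sum_congr rfl fun x' _ =>
      Finset.sum_congr rfl fun x _ => ?_
    ring
  · intro ρ
    have h2 : ∀ (x x' : ∀ j, X j), ∑ y : (∀ p : (Σ j, S j), Y p.1 p.2),
        ∏ j, Φ j (Matrix.single (x j) (x' j) 1) (fun s => y ⟨j, s⟩) (fun s => y ⟨j, s⟩) =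
        if x = x' then 1 else 0 := by
      intro x x'
      rw [← (Equiv.piCurry (fun j s => Y j s)).symm.sum_comp]
      have h3 : ∀ z : (∀ j s, Y j s),
          ∏ j, Φ j (Matrix.single (x j) (x' j) 1)
            (fun s => (Equiv.piCurry (fun j s => Y j s)).symm z ⟨j, s⟩)
            (fun s => (Equiv.piCurry (fun j s => Y j s)).symm z ⟨j, s⟩) =
          ∏ j, Φ j (Matrix.single (x j) (x' j) 1) (z j) (z j) := fun z => rfl
      simp only [h3]
      rw [← Fintype.prod_sum
        (f := fun j z => Φ j (Matrix.single (x j) (x' j) 1) z z)]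
      have h4 : ∀ j, ∑ z, Φ j (Matrix.single (x j) (x' j) 1) z z =
          if x j = x' j then 1 else 0 := by
        intro j
        have := (hΦ j).2 (Matrix.single (x j) (x' j) 1)
        rw [Matrix.trace] at this
        simp only [Matrix.diag_apply] at this
        rw [this]
        split_ifs with h
        · rw [h]; simp
        · simp [h]
      simp only [h4]
      rw [Finset.prod_ite_zero]
      simp [funext_iff]
    simp only [Matrix.trace, Matrix.diag_apply, tensorMap_apply]
    rw [Finset.sum_comm]
    refine Finset.sum_congr rfl fun x _ => ?_
    rw [Finset.sum_comm]
    simp [← Finset.mul_sum, h2]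

/-! ### Encodings of a secret into shares -/

/-- A channel that encodes a secret system with basis `σ` into finitely many quantum shares,
the share `i` being a system with basis `Basis i`. -/
structure Encoding (σ : Type) [Fintype σ] where
  Share : Type
  [fintypeShare : Fintype Share]
  [decEqShare : DecidableEq Share]
  Basis : Share → Type
  [fintypeBasis : ∀ i, Fintype (Basis i)]
  [decEqBasis : ∀ i, DecidableEq (Basis i)]
  encode : Matrix σ σ ℂ →ₗ[ℂ] Matrix (∀ i, Basis i) (∀ i, Basis i) ℂ
  isChannel : IsChannel encode

attribute [instance] Encoding.fintypeShare Encoding.decEqShare Encoding.fintypeBasis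
  Encoding.decEqBasis

/-- The shares in `S` suffice to reconstruct every secret state. -/
def Encoding.CanRecover {σ : Type} [Fintype σ] (E : Encoding σ) (S : Finset E.Share) : Prop :=
  ∃ R : Matrix (∀ i : {i // i ∈ S}, E.Basis i) (∀ i : {i // i ∈ S}, E.Basis i) ℂ →ₗ[ℂ]
      Matrix σ σ ℂ,
    IsChannel R ∧ ∀ ρ, IsDensity ρ → R (reduced S (E.encode ρ)) = ρ

/-- The shares in `S` carry no information: their joint state does not depend on the secret. -/
def Encoding.NoInformation {σ : Type} [Fintype σ] (E : Encoding σ) (S : Finset E.Share) : Prop :=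
  ∀ ρ τ, IsDensity ρ → IsDensity τ → reduced S (E.encode ρ) = reduced S (E.encode τ)

/-- A `((k, n))` quantum threshold scheme. -/
def Encoding.IsThreshold {σ : Type} [Fintype σ] (E : Encoding σ) (k n : ℕ) : Prop :=
  Fintype.card E.Share = n ∧
    ∀ S : Finset E.Share, (k ≤ S.card → E.CanRecover S) ∧ (S.card < k → E.NoInformation S)

/-! ### Assisted schemes -/

/-- An encoding together with a distribution of its shares: `owner i = some p` if the share `i`
is given to the player `p`, and `owner i = none` if it stays with the dealer as a home share. -/
structure Scheme (σ : Type) [Fintype σ] (P : Type) extends Encoding σ where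
  owner : Share → Option P

/-- The number of home shares. -/
def Scheme.homeCount {σ : Type} [Fintype σ] {P : Type} [DecidableEq P] (𝒮 : Scheme σ P) : ℕ :=
  (Finset.univ.filter fun i => 𝒮.owner i = none).card

/-- The shares of the players in `A` together with all home shares. -/
def Scheme.available {σ : Type} [Fintype σ] {P : Type} [DecidableEq P] (𝒮 : Scheme σ P)
    (A : Finset P) : Finset 𝒮.Share :=
  Finset.univ.filter fun i => 𝒮.owner i = none ∨ ∃ p ∈ A, 𝒮.owner i = some p

/-- `𝒮` is an assisted quantum secret sharing scheme for the access structure `Γ` (the family of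
all authorized sets): not every share is a home share, and with the help of the home shares the
sets in `Γ` can reconstruct the secret while all other sets obtain no information about it. -/
def Scheme.Realizes {σ : Type} [Fintype σ] {P : Type} [DecidableEq P] (𝒮 : Scheme σ P)
    (Γ : Finset (Finset P)) : Prop :=
  𝒮.homeCount < Fintype.card 𝒮.Share ∧
    ∀ A : Finset P, (A ∈ Γ → 𝒮.CanRecover (𝒮.available A)) ∧
      (A ∉ Γ → 𝒮.NoInformation (𝒮.available A))

/-- `𝒮` is a conventional quantum secret sharing scheme for `Γ`: there are no home shares. -/
def Scheme.RealizesConventionally {σ : Type} [Fintype σ] {P : Type} [DecidableEq P]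
    (𝒮 : Scheme σ P) (Γ : Finset (Finset P)) : Prop :=
  𝒮.Realizes Γ ∧ 𝒮.homeCount = 0

/-- The scheme in which the dealer keeps the whole system as a single home share. -/
def Scheme.keep (σ : Type) [Fintype σ] [DecidableEq σ] (P : Type) : Scheme σ P where
  Share := Unit
  Basis := fun _ => σ
  encode :=
    { toFun := fun ρ => ρ.submatrix (fun x => x ()) (fun x => x ())
      map_add' := fun _ _ => rfl
      map_smul' := fun _ _ => rfl }
  isChannel := by
    refine ⟨⟨Unit, inferInstance,
      fun _ => (1 : Matrix σ σ ℂ).submatrix (fun x => x ()) id, fun ρ => ?_⟩, fun ρ => ?_⟩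
    · ext x y
      change ρ (x ()) (y ()) = _
      simp [Matrix.mul_apply, Matrix.one_apply]
    · exact Fintype.sum_equiv (Equiv.funUnique Unit σ) _ _ fun x => rfl
  owner := fun _ => none

/-- Concatenation: the secret is first encoded by `T`, then each share `j` of `T` is in turn
encoded by `Q j`, whose shares are distributed as prescribed by `Q j`. -/
def Scheme.concat {σ : Type} [Fintype σ] {P : Type} (T : Encoding σ)
    (Q : ∀ j : T.Share, Scheme (T.Basis j) P) : Scheme σ P where
  Share := Σ j, (Q j).Share
  Basis := fun p => (Q p.1).Basis p.2
  encode := tensorMap (fun j => (Q j).encode) ∘ₗ T.encode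
  isChannel := (isChannel_tensorMap fun j => (Q j).isChannel).comp T.isChannel
  owner := fun p => (Q p.1).owner p.2

/-! ### Partial link classifications -/

/-- A partition of the authorized sets into partially linked classes: any two sets in the same
class overlap, and any two distinct classes contain a pair of sets that do not. -/
def IsPartialLinkClassification {P : Type} [DecidableEq P] {Γ : Finset (Finset P)}
    (𝒞 : Finpartition Γ) : Prop :=
  (∀ C ∈ 𝒞.parts, ∀ α ∈ C, ∀ β ∈ C, (α ∩ β).Nonempty) ∧
    ∀ C ∈ 𝒞.parts, ∀ D ∈ 𝒞.parts, C ≠ D → ∃ α ∈ C, ∃ β ∈ D, ¬ (α ∩ β).Nonempty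

/-- The size `λ` of the smallest partial link classification. -/
noncomputable def linkNumber {P : Type} [DecidableEq P] (Γ : Finset (Finset P)) : ℕ :=
  sInf {n | ∃ 𝒞 : Finpartition Γ, IsPartialLinkClassification 𝒞 ∧ 𝒞.parts.card = n}

/-- The access structure generated by a class: all sets that contain a member of it. -/
def generated {P : Type} [Fintype P] [DecidableEq P] (C : Finset (Finset P)) :
    Finset (Finset P) :=
  Finset.univ.filter fun A => ∃ α ∈ C, α ⊆ A

end AQSS

/-!
An overlapping monotone access structure extends, by one extra player standing for the environment,
to a self-dual one: a set is authorized exactly when its complement is not. Share the secret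
classically over an abelian group, one summand per unauthorized set of the completion, each player
receiving the summands of the unauthorized sets that avoid the player. Encode `|g⟩` as the uniform
superposition of the share vectors of `g` and discard the share of the extra player. An authorized
set knows the whole share vector classically, and its unauthorized complement leaves the secret
free, so the secret can be read off coherently; an unauthorized set holds a state that does not
depend on the secret, because its complement determines the secret. This yields both the
conventional schemes of the classes and the `((k, n))` threshold schemes with `n < 2 * k`.

For the concatenation, the `λ - 1` home shares of a `((λ, 2λ - 1))` threshold scheme are one share
short of the threshold. A set of players supplies a missing share precisely when it is authorized
for some class, that is, when it belongs to `Γ`. Conversely, monotonicity is forced because a set of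
shares without information has no subset that recovers the secret.
-/

namespace AQSS

open Matrix Finset Function
open scoped ComplexOrder

/-! ### Partial traces along an embedding -/

section TraceOut

variable {n m k l : Type} [Fintype n]

open scoped Classical in
/-- The map that sends the basis vector `|a⟩` to `|f a⟩ ⊗ |g a⟩` and discards the second factor. It
covers the partial traces and the relabellings of basis vectors. -/
noncomputable def traceOut (f : n → m) (g : n → k) : Matrix n n ℂ →ₗ[ℂ] Matrix m m ℂ where
  toFun τ := of fun s s' => ∑ a, ∑ a', if f a = s ∧ f a' = s' ∧ g a = g a' then τ a a' else 0
  map_add' τ υ := by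
    ext s s'
    simp [← sum_add_distrib, ite_add_ite]
  map_smul' c τ := by
    ext s s'
    simp [mul_sum]

open scoped Classical in
theorem traceOut_apply (f : n → m) (g : n → k) (τ : Matrix n n ℂ) (s s' : m) :
    traceOut f g τ s s' =
      ∑ a, ∑ a', if f a = s ∧ f a' = s' ∧ g a = g a' then τ a a' else 0 :=
  rfl

open scoped Classical in
theorem traceOut_single [DecidableEq n] [DecidableEq m] (f : n → m) (g : n → k) (a a' : n) :
    traceOut f g (single a a' 1) = if g a = g a' then single (f a) (f a') 1 else 0 := by
  ext s s'
  rw [traceOut_apply, Fintype.sum_eq_single a fun b hb => by simp [hb.symm],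
    Fintype.sum_eq_single a' fun b hb => by simp [hb.symm]]
  by_cases h : g a = g a' <;> simp [h, single_apply]

theorem traceOut_congr {g : n → k} {g' : n → l} (f : n → m)
    (h : ∀ a a', g a = g a' ↔ g' a = g' a') : traceOut f g = traceOut f g' := by
  classical
  refine ext_linearMap ℂ fun a a' => LinearMap.ext_ring ?_
  simp [traceOut_single, h]

theorem traceOut_comp [Fintype m] {m' k' : Type} (f' : m → m') (g' : m → k') (f : n → m)
    (g : n → k) :
    traceOut f' g' ∘ₗ traceOut f g = traceOut (f' ∘ f) fun a => (g' (f a), g a) := by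
  classical
  refine ext_linearMap ℂ fun a a' => LinearMap.ext_ring ?_
  by_cases h : g a = g a' <;> simp [traceOut_single, h]

theorem isChannel_traceOut [Fintype m] [Finite k] {f : n → m} {g : n → k}
    (h : Injective fun a => (f a, g a)) : IsChannel (traceOut f g) := by
  classical
  have := Fintype.ofFinite k
  refine ⟨⟨k, inferInstance, fun y => of fun s a => if f a = s ∧ g a = y then 1 else 0,
    fun τ => ?_⟩, fun τ => ?_⟩
  · ext s s'
    simp only [traceOut_apply, Matrix.sum_apply, mul_apply, conjTranspose_apply, of_apply,
      sum_mul]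
    rw [sum_comm]
    conv_rhs => rw [sum_comm]
    refine sum_congr rfl fun a' _ => ?_
    rw [sum_comm]
    refine sum_congr rfl fun a _ => ?_
    rw [Fintype.sum_eq_single (g a) fun y hy => by simp [hy.symm]]
    simp only [eq_comm (a := g a)]
    by_cases h₁ : f a = s <;> by_cases h₂ : f a' = s' <;> by_cases h₃ : g a' = g a <;>
      simp [h₁, h₂, h₃]
  · suffices traceLinearMap m ℂ ℂ ∘ₗ traceOut f g = traceLinearMap n ℂ ℂ from
      LinearMap.congr_fun this τ
    refine ext_linearMap ℂ fun a a' => LinearMap.ext_ring ?_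
    have key : f a = f a' ∧ g a = g a' ↔ a = a' := by simpa using h.eq_iff (a := a) (b := a')
    by_cases hg : g a = g a' <;> by_cases hf : f a = f a' <;>
      simp_all [traceOut_single, trace_single_eq_of_ne]

theorem traceOut_equiv_apply [Fintype k] (θ : n ≃ m × k) (τ : Matrix n n ℂ) (s s' : m) :
    traceOut (fun a => (θ a).1) (fun a => (θ a).2) τ s s' =
      ∑ y, τ (θ.symm (s, y)) (θ.symm (s', y)) := by
  classical
  have h : ∀ a a', (if (θ a).1 = s ∧ (θ a').1 = s' ∧ (θ a).2 = (θ a').2 then τ a a' else 0) =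
      ∑ y, if θ a = (s, y) ∧ θ a' = (s', y) then τ a a' else 0 := fun a a' => by
    rw [Fintype.sum_eq_single (θ a).2 fun y hy => by simp [Prod.ext_iff, hy.symm]]
    simp only [Prod.ext_iff, eq_comm (a := (θ a').2), and_true]
  simp only [traceOut_apply, h]
  simp_rw [sum_comm (s := univ (α := n)) (t := univ (α := k))]
  simp [ite_and, ← Equiv.eq_symm_apply]

theorem traceOut_id_const (c : k) : traceOut (id : n → n) (fun _ => c) = LinearMap.id := by
  classical
  refine ext_linearMap ℂ fun a a' => LinearMap.ext_ring ?_
  simp [traceOut_single]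

theorem traceOut_const_id (s : m) [DecidableEq m] (τ : Matrix n n ℂ) :
    traceOut (fun _ => s) id τ = τ.trace • single s s 1 := by
  classical
  suffices traceOut (fun _ => s) id = (traceLinearMap n ℂ ℂ).smulRight (single s s (1 : ℂ)) from
    LinearMap.congr_fun this τ
  refine ext_linearMap ℂ fun a a' => LinearMap.ext_ring ?_
  by_cases h : a = a' <;> simp [traceOut_single, h, trace_single_eq_of_ne]

/-- The channel that renames the basis vectors along `e`. -/
noncomputable abbrev relabel (e : n ≃ m) : Matrix n n ℂ →ₗ[ℂ] Matrix m m ℂ :=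
  (reindexLinearEquiv ℂ ℂ e e).toLinearMap

theorem relabel_eq_traceOut (e : n ≃ m) : relabel e = traceOut e fun _ => () := by
  classical
  refine ext_linearMap ℂ fun a a' => LinearMap.ext_ring ?_
  simp [traceOut_single]

theorem isChannel_relabel [Fintype m] (e : n ≃ m) : IsChannel (relabel e) :=
  relabel_eq_traceOut e ▸ isChannel_traceOut fun _ _ h => e.injective (Prod.ext_iff.mp h).1

end TraceOut

section Reduced

variable {ι : Type} [Fintype ι] [DecidableEq ι] {X : ι → Type} [∀ i, Fintype (X i)]

/-- The partial trace `reduced S`, as a linear map. -/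
noncomputable def reducedMap (S : Finset ι) : Matrix (∀ i, X i) (∀ i, X i) ℂ →ₗ[ℂ]
    Matrix (∀ i : {i // i ∈ S}, X i) (∀ i : {i // i ∈ S}, X i) ℂ :=
  traceOut (fun x i => x i) fun x (i : {i // i ∉ S}) => x i

theorem reducedMap_apply (S : Finset ι) (ρ : Matrix (∀ i, X i) (∀ i, X i) ℂ) :
    reducedMap S ρ = reduced S ρ := by
  ext a b
  exact traceOut_equiv_apply (Equiv.piEquivPiSubtypeProd (· ∈ S) X) ρ a b

theorem isChannel_reducedMap (S : Finset ι) : IsChannel (reducedMap (X := X) S) :=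
  isChannel_traceOut (Equiv.piEquivPiSubtypeProd (· ∈ S) X).injective

theorem exists_comp_reducedMap_univ (X : ι → Type) [∀ i, Fintype (X i)] :
    ∃ U, IsChannel U ∧ U ∘ₗ reducedMap (X := X) univ = LinearMap.id := by
  refine ⟨traceOut (fun y i => y ⟨i, mem_univ i⟩) fun _ => (),
    isChannel_traceOut fun y y' h => ?_, ?_⟩
  · funext i
    exact congrFun (Prod.ext_iff.mp h).1 i
  · rw [reducedMap, traceOut_comp, ← traceOut_id_const ()]
    exact traceOut_congr _ fun x x' => by simp [funext_iff]

theorem reducedMap_eq_comp_of_subset {S S' : Finset ι} (h : S ⊆ S') :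
    ∃ F, reducedMap (X := X) S = F ∘ₗ reducedMap S' := by
  refine ⟨traceOut (fun y i => y ⟨i, h i.2⟩) fun y (i : {i : {i // i ∈ S'} // i.1 ∉ S}) => y i,
    ?_⟩
  rw [reducedMap, reducedMap, traceOut_comp]
  refine traceOut_congr _ fun x x' => ?_
  simp only [Prod.ext_iff, funext_iff, Subtype.forall]
  exact ⟨fun hx => ⟨fun i _ hi => hx i hi, fun i hi => hx i fun hS => hi (h hS)⟩,
    fun hx i hi => if hi' : i ∈ S' then hx.1 i hi' hi else hx.2 i hi'⟩

/-- Replaces the factors outside `S` by the basis state `|x₀⟩`. The result is a copy of the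
reduced operator on `S` that still has all factors. -/
noncomputable def reset (S : Finset ι) (x₀ : ∀ i, X i) :
    Matrix (∀ i, X i) (∀ i, X i) ℂ →ₗ[ℂ] Matrix (∀ i, X i) (∀ i, X i) ℂ :=
  traceOut (fun x => S.piecewise x x₀) fun x (i : {i // i ∉ S}) => x i

theorem reducedMap_comp_reset (S : Finset ι) (x₀ : ∀ i, X i) :
    reducedMap S ∘ₗ reset S x₀ = reducedMap S := by
  rw [reducedMap, reset, traceOut_comp]
  have h : ((fun x i => x i : (∀ i, X i) → ∀ i : {i // i ∈ S}, X i) ∘ fun x =>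
      S.piecewise x x₀) = fun x i => x i := by
    ext x i
    exact S.piecewise_eq_of_mem _ _ i.2
  rw [h]
  refine traceOut_congr _ fun x x' => ?_
  simp only [Prod.ext_iff, funext_iff, Subtype.forall]
  exact and_iff_right_of_imp fun _ i hi => by simp [hi]

theorem reset_eq_comp_reducedMap (S : Finset ι) (x₀ : ∀ i, X i) :
    ∃ F, reset S x₀ = F ∘ₗ reducedMap S := by
  refine ⟨traceOut (fun y i => if h : i ∈ S then y ⟨i, h⟩ else x₀ i) fun _ => (), ?_⟩
  rw [reducedMap, traceOut_comp, reset]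
  exact traceOut_congr _ fun x x' => by simp

end Reduced

/-! ### Tensor products of maps -/

section PiMap

variable {ι : Type} [Fintype ι] {X Y Z : ι → Type}

/-- The product operator `⨂ j, A j`. -/
def productOp (A : ∀ j, Matrix (X j) (Y j) ℂ) : Matrix (∀ j, X j) (∀ j, Y j) ℂ :=
  of fun x y => ∏ j, A j (x j) (y j)

theorem productOp_apply (A : ∀ j, Matrix (X j) (Y j) ℂ) (x : ∀ j, X j) (y : ∀ j, Y j) :
    productOp A x y = ∏ j, A j (x j) (y j) :=
  rfl

theorem productOp_single [∀ j, DecidableEq (X j)] [∀ j, DecidableEq (Y j)]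
    (x : ∀ j, X j) (y : ∀ j, Y j) :
    productOp (fun j => single (x j) (y j) (1 : ℂ)) = single x y 1 := by
  classical
  ext x' y'
  simp [productOp_apply, single_apply, prod_ite_zero, funext_iff, forall_and]

variable [DecidableEq ι] [∀ j, Fintype (X j)] [∀ j, DecidableEq (X j)]

/-- The tensor product of maps `Φ j` whose outputs are single factors. -/
noncomputable def piMap (Φ : ∀ j, Matrix (X j) (X j) ℂ →ₗ[ℂ] Matrix (Y j) (Y j) ℂ) :
    Matrix (∀ j, X j) (∀ j, X j) ℂ →ₗ[ℂ] Matrix (∀ j, Y j) (∀ j, Y j) ℂ :=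
  relabel ((Equiv.piCurry fun j (_ : Unit) => Y j).trans (.piCongrRight fun _ => .funUnique _ _))
    ∘ₗ tensorMap fun j => relabel (Equiv.funUnique Unit (Y j)).symm ∘ₗ Φ j

theorem piMap_apply (Φ : ∀ j, Matrix (X j) (X j) ℂ →ₗ[ℂ] Matrix (Y j) (Y j) ℂ)
    (τ : Matrix (∀ j, X j) (∀ j, X j) ℂ) (y y' : ∀ j, Y j) :
    piMap Φ τ y y' =
      ∑ x, ∑ x', τ x x' * ∏ j, Φ j (single (x j) (x' j) 1) (y j) (y' j) :=
  rfl

theorem isChannel_piMap [∀ j, Fintype (Y j)]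
    {Φ : ∀ j, Matrix (X j) (X j) ℂ →ₗ[ℂ] Matrix (Y j) (Y j) ℂ} (hΦ : ∀ j, IsChannel (Φ j)) :
    IsChannel (piMap Φ) :=
  (isChannel_relabel _).comp (isChannel_tensorMap fun j => (isChannel_relabel _).comp (hΦ j))

theorem tensorMap_eq_relabel_comp_piMap {S : ι → Type} {Y : ∀ j, S j → Type}
    (Φ : ∀ j, Matrix (X j) (X j) ℂ →ₗ[ℂ] Matrix (∀ s, Y j s) (∀ s, Y j s) ℂ) :
    tensorMap Φ = relabel (Equiv.piCurry Y).symm ∘ₗ piMap Φ :=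
  rfl

theorem piMap_productOp (Φ : ∀ j, Matrix (X j) (X j) ℂ →ₗ[ℂ] Matrix (Y j) (Y j) ℂ)
    (A : ∀ j, Matrix (X j) (X j) ℂ) :
    piMap Φ (productOp A) = productOp fun j => Φ j (A j) := by
  ext y y'
  have h : ∀ j, Φ j (A j) (y j) (y' j) =
      ∑ a, ∑ a', A j a a' * Φ j (single a a' 1) (y j) (y' j) := fun j => by
    conv_lhs => rw [matrix_eq_sum_single (A j)]
    simp only [map_sum, Matrix.sum_apply]
    refine sum_congr rfl fun a _ => sum_congr rfl fun a' _ => ?_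
    rw [← smul_eq_mul, ← Matrix.smul_apply, ← map_smul, smul_single, smul_eq_mul, mul_one]
  simp only [piMap_apply, productOp_apply, h, Fintype.prod_sum, prod_mul_distrib]

theorem piMap_single (Φ : ∀ j, Matrix (X j) (X j) ℂ →ₗ[ℂ] Matrix (Y j) (Y j) ℂ)
    (x x' : ∀ j, X j) :
    piMap Φ (single x x' 1) = productOp fun j => Φ j (single (x j) (x' j) 1) := by
  rw [← productOp_single, piMap_productOp]

theorem piMap_comp [∀ j, Fintype (Y j)] [∀ j, DecidableEq (Y j)]
    (Ψ : ∀ j, Matrix (Y j) (Y j) ℂ →ₗ[ℂ] Matrix (Z j) (Z j) ℂ)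
    (Φ : ∀ j, Matrix (X j) (X j) ℂ →ₗ[ℂ] Matrix (Y j) (Y j) ℂ) :
    piMap Ψ ∘ₗ piMap Φ = piMap fun j => Ψ j ∘ₗ Φ j := by
  refine ext_linearMap ℂ fun x x' => LinearMap.ext_ring ?_
  simp [piMap_single, piMap_productOp]

theorem piMap_traceOut {k : ι → Type} (f : ∀ j, X j → Y j) (g : ∀ j, X j → k j) :
    piMap (fun j => traceOut (f j) (g j)) = traceOut (Pi.map f) (Pi.map g) := by
  classical
  refine ext_linearMap ℂ fun x x' => LinearMap.ext_ring ?_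
  simp only [LinearMap.comp_apply, singleLinearMap_apply, piMap_single, traceOut_single]
  ext y y'
  by_cases h : Pi.map g x = Pi.map g x'
  · have hj : ∀ j, g j (x j) = g j (x' j) := congrFun h
    simp only [if_pos h, if_pos (hj _), ← productOp_single, Pi.map_apply]
  · obtain ⟨j, hj : g j (x j) ≠ g j (x' j)⟩ := Function.ne_iff.mp h
    rw [if_neg h, productOp_apply, prod_eq_zero (mem_univ j) (by simp [hj]),
      Matrix.zero_apply]

theorem piMap_reset (S : Finset ι) (x₀ : ∀ j, X j) :
    piMap (fun j => if j ∈ S then LinearMap.id else traceOut (fun _ => x₀ j) id) =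
      reset S x₀ := by
  have h : ∀ j, (if j ∈ S then LinearMap.id else traceOut (fun _ => x₀ j) id) =
      traceOut (fun a : X j => if j ∈ S then a else x₀ j) fun a (_ : j ∉ S) => a := fun j => by
    split_ifs with hj
    · rw [← traceOut_id_const ()]
      exact traceOut_congr _ fun a a' => by simp [funext_iff, hj]
    · exact traceOut_congr _ fun a a' => by simp [funext_iff, hj]
  simp only [h, piMap_traceOut, reset]
  exact traceOut_congr _ fun x x' => by simp [funext_iff]

end PiMap

section Sigma

variable {ι : Type} [Fintype ι] {S : ι → Type} {Y : ∀ j, S j → Type}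

/-- Labels of the factors `⟨j, s⟩` with `s ∈ V j`, curried. -/
def sigmaLabels (V : ∀ j, Finset (S j)) :
    (∀ p : {p : Σ j, S j // p ∈ univ.sigma V}, Y p.1.1 p.1.2) ≃
      ∀ j, ∀ s : {s // s ∈ V j}, Y j s where
  toFun a j s := a ⟨⟨j, s⟩, by simp⟩
  invFun y p := y p.1.1 ⟨p.1.2, (mem_sigma.mp p.2).2⟩
  left_inv _ := rfl
  right_inv _ := rfl

theorem reducedMap_sigma_comp_tensorMap [DecidableEq ι] {X : ι → Type} [∀ j, Fintype (X j)]
    [∀ j, DecidableEq (X j)] [∀ j, Fintype (S j)] [∀ j, DecidableEq (S j)]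
    [∀ j s, Fintype (Y j s)] (V : ∀ j, Finset (S j))
    (Φ : ∀ j, Matrix (X j) (X j) ℂ →ₗ[ℂ] Matrix (∀ s, Y j s) (∀ s, Y j s) ℂ) :
    reducedMap (univ.sigma V) ∘ₗ tensorMap Φ =
      relabel (sigmaLabels V).symm ∘ₗ piMap fun j => reducedMap (V j) ∘ₗ Φ j := by
  classical
  rw [tensorMap_eq_relabel_comp_piMap, ← piMap_comp, ← LinearMap.comp_assoc,
    ← LinearMap.comp_assoc]
  congr 1
  simp only [reducedMap, relabel_eq_traceOut, piMap_traceOut, traceOut_comp]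
  refine traceOut_congr _ fun y y' => ?_
  simp [funext_iff, Equiv.piCurry, Sigma.forall, Sigma.uncurry]

end Sigma

/-! ### States -/

section Density

variable {n : Type} [Fintype n]

theorem isDensity_single [DecidableEq n] (i : n) : IsDensity (single i i (1 : ℂ)) := by
  refine ⟨?_, trace_single_eq_same i 1⟩
  rw [← diagonal_single]
  exact PosSemidef.diagonal (Pi.single_nonneg.mpr zero_le_one)

open scoped MatrixOrder Matrix.Norms.L2Operator in
theorem span_isDensity : Submodule.span ℂ {ρ : Matrix n n ℂ | IsDensity ρ} = ⊤ := by
  classical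
  rw [eq_top_iff, ← CStarAlgebra.span_nonneg, Submodule.span_le]
  intro τ hτ
  have hpos : τ.PosSemidef := nonneg_iff_posSemidef.mp hτ
  by_cases h : τ.trace = 0
  · rw [hpos.trace_eq_zero_iff.mp h]
    exact zero_mem _
  · rw [← smul_inv_smul₀ h τ]
    refine Submodule.smul_mem _ _ (Submodule.subset_span ⟨?_, ?_⟩)
    · exact hpos.smul (inv_nonneg.mpr hpos.trace_nonneg)
    · rw [trace_smul, smul_eq_mul, inv_mul_cancel₀ h]

end Density

/-! ### Recovery and secrecy as identities of channels -/

section Encoding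

variable {σ : Type} [Fintype σ] {E : Encoding σ} {S S' : Finset E.Share}

/-- The channel from the secret to the joint state of the shares in `S`. -/
noncomputable def Encoding.shareChannel (E : Encoding σ) (S : Finset E.Share) :
    Matrix σ σ ℂ →ₗ[ℂ]
      Matrix (∀ i : {i // i ∈ S}, E.Basis i) (∀ i : {i // i ∈ S}, E.Basis i) ℂ :=
  reducedMap S ∘ₗ E.encode

theorem Encoding.shareChannel_apply (ρ : Matrix σ σ ℂ) :
    E.shareChannel S ρ = reduced S (E.encode ρ) :=
  reducedMap_apply S _

theorem Encoding.isChannel_shareChannel : IsChannel (E.shareChannel S) :=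
  (isChannel_reducedMap S).comp E.isChannel

theorem Encoding.canRecover_iff :
    E.CanRecover S ↔ ∃ R, IsChannel R ∧ R ∘ₗ E.shareChannel S = LinearMap.id := by
  simp only [Encoding.CanRecover, ← shareChannel_apply]
  refine exists_congr fun R => and_congr_right fun _ => ⟨fun h => ?_, fun h ρ _ => ?_⟩
  · exact LinearMap.ext_on span_isDensity h
  · exact LinearMap.congr_fun h ρ

theorem Encoding.canRecover_univ
    {D : Matrix (∀ i, E.Basis i) (∀ i, E.Basis i) ℂ →ₗ[ℂ] Matrix σ σ ℂ} (hD : IsChannel D)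
    (h : D ∘ₗ E.encode = LinearMap.id) : E.CanRecover univ := by
  obtain ⟨U, hU, hUid⟩ := exists_comp_reducedMap_univ E.Basis
  refine Encoding.canRecover_iff.mpr ⟨D ∘ₗ U, hD.comp hU, ?_⟩
  rw [Encoding.shareChannel, LinearMap.comp_assoc, ← LinearMap.comp_assoc _ _ U, hUid,
    LinearMap.id_comp, h]

theorem Encoding.noInformation_iff [Nonempty σ] :
    E.NoInformation S ↔ ∃ ω, ∀ ρ, E.shareChannel S ρ = ρ.trace • ω := by
  classical
  simp only [Encoding.NoInformation, ← shareChannel_apply]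
  constructor
  · intro h
    obtain ⟨i⟩ := ‹Nonempty σ›
    refine ⟨E.shareChannel S (single i i 1), fun ρ => ?_⟩
    suffices E.shareChannel S = (traceLinearMap σ ℂ ℂ).smulRight
        (E.shareChannel S (single i i 1)) from LinearMap.congr_fun this ρ
    refine LinearMap.ext_on span_isDensity fun τ hτ => ?_
    simp [h τ _ hτ (isDensity_single i), hτ.2]
  · rintro ⟨ω, hω⟩ ρ τ hρ hτ
    rw [hω, hω, hρ.2, hτ.2]

theorem Encoding.NoInformation.mono (h : S ⊆ S') (hS' : E.NoInformation S') :
    E.NoInformation S := by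
  intro ρ τ hρ hτ
  obtain ⟨F, hF⟩ := reducedMap_eq_comp_of_subset (X := E.Basis) h
  simp only [← reducedMap_apply, hF, LinearMap.comp_apply]
  rw [reducedMap_apply, reducedMap_apply, hS' ρ τ hρ hτ]

theorem Encoding.CanRecover.not_noInformation [Nontrivial σ] (h : E.CanRecover S) :
    ¬ E.NoInformation S := by
  classical
  intro h'
  obtain ⟨R, -, hR⟩ := h
  obtain ⟨i, j, hij⟩ := exists_pair_ne σ
  have hi := hR _ (isDensity_single i)
  rw [h' _ _ (isDensity_single i) (isDensity_single j), hR _ (isDensity_single j)] at hi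
  have hii := congrFun (congrFun hi i) i
  simp [hij.symm] at hii

theorem Encoding.nonempty_basis [Nonempty σ] (E : Encoding σ) : Nonempty (∀ i, E.Basis i) := by
  classical
  by_contra h
  have : IsEmpty (∀ i, E.Basis i) := not_nonempty_iff.mp h
  obtain ⟨i⟩ := ‹Nonempty σ›
  have htrace := E.isChannel.2 (single i i 1)
  simp [Matrix.trace] at htrace

end Encoding

/-! ### Concatenation -/

section Concat

variable {σ P : Type} [Fintype σ] (T : Encoding σ) (Q : ∀ j : T.Share, Scheme (T.Basis j) P)
  {J : Finset T.Share} {V : ∀ j, Finset (Q j).Share}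

/-- The shares of a concatenation that come from the shares in `V j` of the scheme `Q j`. -/
def concatShares (V : ∀ j, Finset (Q j).Share) : Finset (Scheme.concat T Q).Share :=
  (univ : Finset T.Share).sigma V

/-- Labels of the shares in `concatShares T Q V`, grouped by the scheme they come from. -/
def concatLabels (V : ∀ j, Finset (Q j).Share) :
    (∀ p : {p // p ∈ concatShares T Q V}, (Scheme.concat T Q).Basis p) ≃
      ∀ j, ∀ s : {s // s ∈ V j}, (Q j).Basis s :=
  sigmaLabels (Y := fun j s => (Q j).Basis s) V

theorem shareChannel_concat (V : ∀ j, Finset (Q j).Share) :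
    (Scheme.concat T Q).shareChannel (concatShares T Q V) =
      relabel (concatLabels T Q V).symm ∘ₗ
        (piMap fun j => (Q j).shareChannel (V j)) ∘ₗ T.encode :=
  congrArg (· ∘ₗ T.encode) (reducedMap_sigma_comp_tensorMap V fun j => (Q j).encode)

variable {T Q}

theorem Encoding.CanRecover.concat [Nonempty σ] (hT : T.CanRecover J)
    (hQ : ∀ j ∈ J, (Q j).CanRecover (V j)) :
    (Scheme.concat T Q).CanRecover (concatShares T Q V) := by
  obtain ⟨x₀⟩ := T.nonempty_basis
  obtain ⟨R, hR, hRT⟩ := Encoding.canRecover_iff.mp hT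
  have hD : ∀ j, ∃ D, IsChannel D ∧ D ∘ₗ (Q j).shareChannel (V j) =
      if j ∈ J then LinearMap.id else traceOut (fun _ => x₀ j) id := by
    intro j
    split_ifs with hj
    · exact Encoding.canRecover_iff.mp (hQ j hj)
    · refine ⟨traceOut (fun _ => x₀ j) id, isChannel_traceOut fun _ _ h => (Prod.ext_iff.mp h).2,
        LinearMap.ext fun τ => ?_⟩
      rw [LinearMap.comp_apply, traceOut_const_id, traceOut_const_id,
        Encoding.isChannel_shareChannel.2]
  choose D hD hDQ using hD
  refine Encoding.canRecover_iff.mpr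
    ⟨R ∘ₗ reducedMap J ∘ₗ piMap D ∘ₗ relabel (concatLabels T Q V),
      hR.comp ((isChannel_reducedMap J).comp ((isChannel_piMap hD).comp (isChannel_relabel _))),
      LinearMap.ext fun ρ => ?_⟩
  have hDρ : piMap D (piMap (fun j => (Q j).shareChannel (V j)) (T.encode ρ)) =
      reset J x₀ (T.encode ρ) := by
    rw [← LinearMap.comp_apply, piMap_comp, ← piMap_reset]
    simp only [hDQ]
  have hJ : reducedMap J (reset J x₀ (T.encode ρ)) = T.shareChannel J ρ :=
    LinearMap.congr_fun (reducedMap_comp_reset J x₀) (T.encode ρ)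
  simp only [shareChannel_concat, LinearMap.comp_apply]
  have hrel : ∀ τ, relabel (concatLabels T Q V) (relabel (concatLabels T Q V).symm τ) = τ :=
    fun τ => by simp
  rw [hrel, hDρ, hJ, ← LinearMap.comp_apply, hRT]

theorem Encoding.NoInformation.concat [Nonempty σ] (hT : T.NoInformation J)
    (hQ : ∀ j ∉ J, (Q j).NoInformation (V j)) :
    (Scheme.concat T Q).NoInformation (concatShares T Q V) := by
  obtain ⟨x₀⟩ := T.nonempty_basis
  have hreset : (piMap fun j => (Q j).shareChannel (V j)) =
      (piMap fun j => (Q j).shareChannel (V j)) ∘ₗ reset J x₀ := by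
    rw [← piMap_reset, piMap_comp]
    congr 1
    funext j
    split_ifs with hj
    · rfl
    · have : Nonempty (T.Basis j) := ⟨x₀ j⟩
      obtain ⟨ω, hω⟩ := Encoding.noInformation_iff.mp (hQ j hj)
      ext1 τ
      simp [hω, traceOut_const_id]
  obtain ⟨F, hF⟩ := reset_eq_comp_reducedMap J x₀
  intro ρ τ hρ hτ
  simp only [← Encoding.shareChannel_apply, shareChannel_concat, LinearMap.comp_apply]
  rw [hreset, hF]
  simp only [LinearMap.comp_apply, reducedMap_apply, hT ρ τ hρ hτ]

end Concat

/-! ### Schemes -/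

section Scheme

variable {σ P : Type} [Fintype σ] [DecidableEq P]

theorem Scheme.available_mono (𝒮 : Scheme σ P) {A B : Finset P} (h : A ⊆ B) :
    𝒮.available A ⊆ 𝒮.available B :=
  monotone_filter_right _ fun _ _ => Or.imp_right fun ⟨p, hp, hi⟩ => ⟨p, h hp, hi⟩

theorem Scheme.Realizes.isUpperSet [Nontrivial σ] {𝒮 : Scheme σ P} {Γ : Finset (Finset P)}
    (h : 𝒮.Realizes Γ) : IsUpperSet (Γ : Set (Finset P)) := by
  intro A B hAB hA
  by_contra hB
  exact ((h.2 A).1 hA).not_noInformation (((h.2 B).2 hB).mono (𝒮.available_mono hAB))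

theorem Scheme.homeCount_lt_card_iff {𝒮 : Scheme σ P} :
    𝒮.homeCount < Fintype.card 𝒮.Share ↔ ∃ i, 𝒮.owner i ≠ none := by
  simp [Scheme.homeCount, card_lt_iff_ne_univ, Finset.ext_iff]

theorem Scheme.homeCount_keep [DecidableEq σ] : (Scheme.keep σ P).homeCount = 1 :=
  (congrArg card (filter_true_of_mem fun _ _ => rfl)).trans Fintype.card_unit

theorem Scheme.canRecover_keep [DecidableEq σ] (A : Finset P) :
    (Scheme.keep σ P).CanRecover ((Scheme.keep σ P).available A) := by
  have huniv : (Scheme.keep σ P).available A = univ :=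
    filter_true_of_mem fun _ _ => Or.inl rfl
  rw [huniv]
  exact Encoding.canRecover_univ (isChannel_relabel (Equiv.funUnique Unit σ)) rfl

variable (T : Encoding σ) (Q : ∀ j : T.Share, Scheme (T.Basis j) P)

theorem Scheme.available_concat (A : Finset P) : (Scheme.concat T Q).available A =
    concatShares T Q fun j => (Q j).available A := by
  ext p
  refine Iff.trans ?_ mem_sigma.symm
  simp only [Scheme.available, mem_filter, mem_univ, true_and]
  rfl

theorem Scheme.homeCount_concat : (Scheme.concat T Q).homeCount = ∑ j, (Q j).homeCount := by
  simp only [Scheme.homeCount]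
  rw [← card_sigma]
  congr 1
  ext p
  refine Iff.trans ?_ mem_sigma.symm
  simp only [mem_filter, mem_univ, true_and]
  rfl

variable {T Q} {κ : Type} [Fintype κ] {f : κ → T.Share}

theorem Scheme.homeCount_concat_add_card (hf : Injective f)
    (hQ : ∀ c, (Q (f c)).homeCount = 0) (hkeep : ∀ j ∉ Set.range f, Q j = Scheme.keep _ P) :
    (Scheme.concat T Q).homeCount + Fintype.card κ = Fintype.card T.Share := by
  classical
  have h : ∀ j, (Q j).homeCount = if j ∉ univ.image f then 1 else 0 := fun j => by
    split_ifs with hj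
    · obtain ⟨c, -, rfl⟩ := mem_image.mp hj
      exact hQ c
    · rw [hkeep j (by simpa using hj), Scheme.homeCount_keep]
  rw [Scheme.homeCount_concat, sum_congr rfl fun j _ => h j, ← card_filter,
    filter_notMem_eq_sdiff, ← compl_eq_univ_sdiff, ← card_univ (α := κ),
    ← card_image_of_injective univ hf, card_compl_add_card]

theorem Scheme.concat_realizes [Nonempty σ] [Nonempty κ] {k n : ℕ} (hT : T.IsThreshold k n)
    (hn : n + 1 = k + Fintype.card κ) (hf : Injective f) {𝒢 : κ → Finset (Finset P)}
    (hQ : ∀ c, (Q (f c)).RealizesConventionally (𝒢 c))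
    (hkeep : ∀ j ∉ Set.range f, Q j = Scheme.keep _ P) {Γ : Finset (Finset P)}
    (hΓ : ∀ A, A ∈ Γ ↔ ∃ c, A ∈ 𝒢 c) : (Scheme.concat T Q).Realizes Γ := by
  classical
  have hcard : (univ.image f)ᶜ.card + 1 = k := by
    have := card_add_card_compl (univ.image f)
    rw [card_image_of_injective _ hf, card_univ, hT.1] at this
    omega
  refine ⟨?_, fun A => ⟨fun hA => ?_, fun hA => ?_⟩⟩
  · obtain ⟨c⟩ := ‹Nonempty κ›
    obtain ⟨s, hs⟩ := Scheme.homeCount_lt_card_iff.mp (hQ c).1.1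
    exact Scheme.homeCount_lt_card_iff.mpr ⟨⟨f c, s⟩, hs⟩
  · obtain ⟨c, hc⟩ := (hΓ A).mp hA
    rw [Scheme.available_concat]
    have hnot : f c ∉ (univ.image f)ᶜ := by simp
    have hrec : T.CanRecover (insert (f c) (univ.image f)ᶜ) :=
      (hT.2 _).1 (by rw [card_insert_of_notMem hnot, hcard])
    refine hrec.concat fun j hj => ?_
    rcases mem_insert.mp hj with rfl | hj
    · exact ((hQ c).1.2 A).1 hc
    · rw [hkeep j (by simpa using hj)]
      exact Scheme.canRecover_keep A
  · rw [Scheme.available_concat]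
    have hhide : T.NoInformation (univ.image f)ᶜ := (hT.2 _).2 (by omega)
    refine hhide.concat fun j hj => ?_
    obtain ⟨c, rfl⟩ : ∃ c, f c = j := by simpa using hj
    exact ((hQ c).1.2 A).2 fun hc => hA ((hΓ A).mpr ⟨c, hc⟩)

end Scheme

/-! ### Superposition codes -/

section Superpose

variable {C σ A F : Type} [AddCommGroup C] [AddCommGroup σ] {L : C →+ σ}

/-- The isometric encoding of `|g⟩` as the uniform superposition of the codewords `k` with
`L k = g`. -/
noncomputable def superpose (L : C →+ σ) : Matrix σ σ ℂ →ₗ[ℂ] Matrix C C ℂ where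
  toFun ρ := (Nat.card L.ker : ℂ)⁻¹ • ρ.submatrix L L
  map_add' ρ τ := by simp [submatrix_add]
  map_smul' c ρ := by simp [submatrix_smul, smul_comm c]

theorem superpose_apply_apply (ρ : Matrix σ σ ℂ) (k k' : C) :
    superpose L ρ k k' = (Nat.card L.ker : ℂ)⁻¹ * ρ (L k) (L k') :=
  rfl

/-- The element of the kernel of `L` by which `k` differs from the representative `w (L k)`. -/
def kerPart {w : σ → C} (hw : ∀ g, L (w g) = g) (k : C) : L.ker :=
  ⟨k - w (L k), by simp [AddMonoidHom.mem_ker, hw]⟩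

/-- A codeword is determined by its secret and its kernel part. -/
def codewordEquiv {w : σ → C} (hw : ∀ g, L (w g) = g) : C ≃ σ × L.ker where
  toFun k := (L k, kerPart hw k)
  invFun p := w p.1 + p.2
  left_inv k := by simp [kerPart]
  right_inv p := by
    have hp : L (w p.1 + p.2) = p.1 := by rw [map_add, hw, p.2.2, add_zero]
    ext <;> simp [kerPart, hp]

theorem map_codewordEquiv_symm {w : σ → C} (hw : ∀ g, L (w g) = g) (p : σ × L.ker) :
    L ((codewordEquiv hw).symm p) = p.1 :=
  congrArg Prod.fst ((codewordEquiv hw).apply_symm_apply p)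

variable [Fintype C]

theorem traceOut_comp_superpose {w : σ → C} (hw : ∀ g, L (w g) = g) :
    traceOut L (kerPart hw) ∘ₗ superpose L = LinearMap.id := by
  have := Fintype.ofFinite L.ker
  refine LinearMap.ext fun ρ => ?_
  ext g g'
  refine (traceOut_equiv_apply (codewordEquiv hw) _ g g').trans ?_
  simp only [superpose_apply_apply, map_codewordEquiv_symm, sum_const, card_univ, nsmul_eq_mul,
    Nat.card_eq_fintype_card, LinearMap.id_apply]
  exact mul_inv_cancel_left₀ (Nat.cast_ne_zero.mpr Fintype.card_ne_zero) _

variable [Fintype σ]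

theorem traceOut_kerPart_superpose {w : σ → C} (hw : ∀ g, L (w g) = g) (ρ : Matrix σ σ ℂ) :
    traceOut (kerPart hw) L (superpose L ρ) =
      ρ.trace • (Nat.card L.ker : ℂ)⁻¹ • of fun _ _ => 1 := by
  ext c c'
  refine (traceOut_equiv_apply ((codewordEquiv hw).trans (.prodComm _ _)) _ c c').trans ?_
  have hdiag : ∀ g, superpose L ρ ((codewordEquiv hw).symm (g, c))
      ((codewordEquiv hw).symm (g, c')) = ρ g g * (Nat.card L.ker : ℂ)⁻¹ := fun g => by
    rw [superpose_apply_apply, map_codewordEquiv_symm, map_codewordEquiv_symm, mul_comm]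
  refine (sum_congr rfl fun g _ => hdiag g).trans ?_
  rw [← sum_mul, Matrix.smul_apply, Matrix.smul_apply, of_apply, smul_eq_mul, smul_eq_mul, mul_one]
  rfl

theorem isChannel_superpose (hL : Surjective L) : IsChannel (superpose L) := by
  classical
  obtain ⟨w, hw⟩ := hL.hasRightInverse
  refine ⟨⟨Unit, inferInstance,
    fun _ => of fun k g => if L k = g then ((√(Nat.card L.ker))⁻¹ : ℝ) else (0 : ℂ),
    fun ρ => ?_⟩, fun ρ => ?_⟩
  · have hsq : (((√(Nat.card L.ker))⁻¹ : ℝ) : ℂ) * ((√(Nat.card L.ker))⁻¹ : ℝ) =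
        (Nat.card L.ker : ℂ)⁻¹ := by
      rw [Complex.ofReal_inv, ← mul_inv, ← Complex.ofReal_mul,
        Real.mul_self_sqrt (Nat.cast_nonneg _), Complex.ofReal_natCast]
    ext k k'
    rw [superpose_apply_apply, ← hsq]
    simp [mul_apply, apply_ite, mul_right_comm]
  · have := Fintype.ofFinite L.ker
    have htrace : (traceOut L (kerPart hw) (superpose L ρ)).trace = (superpose L ρ).trace :=
      (isChannel_traceOut (codewordEquiv hw).injective).2 _
    rw [← htrace, ← LinearMap.comp_apply, traceOut_comp_superpose, LinearMap.id_apply]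

theorem exists_recovery_superpose [AddCommGroup A] [Fintype A] [AddCommGroup F] {a : C →+ A}
    {e : C →+ F} (hae : Injective fun k => (a k, e k)) (ha : ∀ k, a k = 0 → L k = 0)
    (he : ∀ g, ∃ k, e k = 0 ∧ L k = g) :
    ∃ R, IsChannel R ∧ R ∘ₗ traceOut a e ∘ₗ superpose L = LinearMap.id := by
  choose w hew hw using he
  obtain ⟨dec, hdec⟩ : ∃ dec : A → σ, ∀ k, dec (a k) = L k := by
    have hfac : FactorsThrough L a := fun k k' h => by
      rw [← sub_eq_zero, ← map_sub]
      exact ha _ (by rw [map_sub, h, sub_self])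
    exact ⟨extend a L 0, hfac.extend_apply 0⟩
  -- Subtracting `a (w g)` for the decoded secret `g` removes all dependence of the rest on `g`.
  refine ⟨traceOut dec fun x => x - a (w (dec x)), isChannel_traceOut fun x x' h => ?_, ?_⟩
  · obtain ⟨h₁, h₂⟩ := Prod.ext_iff.mp h
    dsimp only at h₁ h₂
    rwa [h₁, sub_left_inj] at h₂
  · rw [← LinearMap.comp_assoc, traceOut_comp, ← traceOut_comp_superpose hw]
    congr 1
    have hdec' : dec ∘ a = L := funext hdec
    rw [hdec']
    refine traceOut_congr _ fun k k' => ?_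
    have hk : ∀ k, (a k - a (w (dec (a k))), e k) = (a (k - w (L k)), e (k - w (L k))) :=
      fun k => by rw [map_sub, map_sub, hew, sub_zero, hdec]
    rw [hk, hk, kerPart, kerPart, Subtype.mk.injEq]
    exact hae.eq_iff

theorem exists_traceOut_superpose_eq_trace_smul [AddCommGroup A] [AddCommGroup F] {a : C →+ A}
    {e : C →+ F} (he : ∀ k, e k = 0 → L k = 0) (ha : ∀ g, ∃ k, a k = 0 ∧ L k = g) :
    ∃ ω, ∀ ρ, traceOut a e (superpose L ρ) = ρ.trace • ω := by
  classical
  choose w haw hw using ha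
  have h : traceOut a e =
      traceOut (fun c : L.ker => a c) (fun c : L.ker => e c) ∘ₗ traceOut (kerPart hw) L := by
    have hker : (fun c : L.ker => a c) ∘ kerPart hw = a := by
      funext k
      simp [kerPart, haw]
    rw [traceOut_comp, hker]
    refine traceOut_congr _ fun k k' => ?_
    have hL : e k = e k' → L k = L k' := fun hk => by
      rw [← sub_eq_zero, ← map_sub]
      exact he _ (by rw [map_sub, hk, sub_self])
    simp only [kerPart, map_sub, Prod.ext_iff]
    exact ⟨fun hk => ⟨by rw [hk, hL hk], hL hk⟩, fun ⟨hk, hk'⟩ => by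
      rwa [hk', sub_left_inj] at hk⟩
  exact ⟨_, fun ρ => by
    rw [h, LinearMap.comp_apply, traceOut_kerPart_superpose, map_smul]⟩

end Superpose

/-! ### Replicated secret sharing -/

section SelfDual

variable {P : Type} [Fintype P] [DecidableEq P] {Γ : Finset (Finset P)}

/-- The self-dual completion of an access structure by the additional player `none`, who will
stand for the environment: `none` joins the coalitions whose complement is unauthorized. -/
def selfDualCompletion (Γ : Finset (Finset P)) : Finset (Finset (Option P)) :=
  univ.filter fun A => A.eraseNone ∈ Γ ∨ none ∈ A ∧ A.eraseNoneᶜ ∉ Γ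

theorem mem_selfDualCompletion {A : Finset (Option P)} :
    A ∈ selfDualCompletion Γ ↔ A.eraseNone ∈ Γ ∨ none ∈ A ∧ A.eraseNoneᶜ ∉ Γ := by
  simp [selfDualCompletion]

theorem isUpperSet_selfDualCompletion (h : IsUpperSet (Γ : Set (Finset P))) :
    IsUpperSet (selfDualCompletion Γ : Set (Finset (Option P))) := by
  intro A B hAB hA
  rw [mem_coe, mem_selfDualCompletion] at hA ⊢
  exact hA.imp (fun hA => h (eraseNone.monotone hAB) hA) fun ⟨hn, hA⟩ =>
    ⟨hAB hn, fun hB => hA (h (compl_le_compl (eraseNone.monotone hAB)) hB)⟩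

theorem map_some_mem_selfDualCompletion {S : Finset P} :
    S.map Embedding.some ∈ selfDualCompletion Γ ↔ S ∈ Γ := by
  simp [mem_selfDualCompletion]

theorem insertNone_compl_mem_selfDualCompletion (h : (Γ : Set (Finset P)).Intersecting)
    {S : Finset P} : insertNone Sᶜ ∈ selfDualCompletion Γ ↔ S ∉ Γ := by
  simp only [mem_selfDualCompletion, eraseNone_insertNone, none_mem_insertNone, compl_compl,
    true_and, or_iff_right_iff_imp]
  exact fun hS hS' => h hS hS' disjoint_compl_left

theorem univ_mem_selfDualCompletion (hΓ : (Γ : Set (Finset P)).Intersecting) :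
    univ ∈ selfDualCompletion Γ := by
  have h : eraseNone (univ : Finset (Option P)) = univ := by
    ext
    simp
  refine mem_selfDualCompletion.mpr (.inr ⟨mem_univ _, ?_⟩)
  rw [h, compl_univ]
  exact hΓ.bot_notMem

theorem empty_notMem_selfDualCompletion (hΓ : (Γ : Set (Finset P)).Intersecting) :
    ∅ ∉ selfDualCompletion Γ := by
  rw [← map_empty Embedding.some, map_some_mem_selfDualCompletion]
  exact hΓ.bot_notMem

end SelfDual

section Replicated

variable {ι σ : Type} {Δ : Finset (Finset ι)}

/-- The codewords of replicated secret sharing: one summand of the secret for every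
unauthorized set. -/
abbrev Codeword (Δ : Finset (Finset ι)) (σ : Type) : Type :=
  {B // B ∉ Δ} → σ

/-- The values of the share of the player `i`: the summands of the unauthorized sets that do not
contain `i`. -/
abbrev ShareValue (Δ : Finset (Finset ι)) (σ : Type) (i : ι) : Type :=
  {B : {B // B ∉ Δ} // i ∉ B.1} → σ

variable [AddCommGroup σ]

/-- The share of the player `i`. -/
def share (i : ι) : Codeword Δ σ →+ ShareValue Δ σ i :=
  AddMonoidHom.pi fun B => Pi.evalAddMonoidHom _ B.1

theorem eq_of_share_eq (hΔ : IsUpperSet (Δ : Set (Finset ι))) {A : Finset ι} (hA : A ∈ Δ)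
    {r r' : Codeword Δ σ} (h : ∀ i ∈ A, share i r = share i r') : r = r' := by
  funext B
  obtain ⟨i, hiA, hiB⟩ := not_subset.mp fun hAB => B.2 (hΔ hAB hA)
  exact congrFun (h i hiA) ⟨B, hiB⟩

variable [Fintype ι] [DecidableEq ι]

/-- The secret encoded by a codeword, the sum of its summands. -/
def secret : Codeword Δ σ →+ σ :=
  ∑ B, Pi.evalAddMonoidHom _ B

theorem exists_share_eq_zero_and_secret_eq {A : Finset ι} (hA : A ∉ Δ) (g : σ) :
    ∃ r : Codeword Δ σ, (∀ i ∈ A, share i r = 0) ∧ secret r = g := by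
  refine ⟨Pi.single ⟨A, hA⟩ g, fun i hi => funext fun B => ?_, ?_⟩
  · have hB : B.1 ≠ ⟨A, hA⟩ := fun hB => B.2 (hB ▸ hi)
    exact Pi.single_eq_of_ne (M := fun _ => σ) hB g
  · simp [secret, AddMonoidHom.finsetSum_apply]

theorem surjective_secret (h : ∅ ∉ Δ) : Surjective (secret : Codeword Δ σ →+ σ) := fun g =>
  (exists_share_eq_zero_and_secret_eq h g).imp fun _ => And.right

end Replicated

section Sharing

variable {P : Type} [Fintype P] [DecidableEq P] {Γ : Finset (Finset P)} {σ : Type}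
  [AddCommGroup σ]

/-- The shares of the players with property `p`. -/
def sharesOf (Γ : Finset (Finset P)) (σ : Type) [AddCommGroup σ] (p : P → Prop) :
    Codeword (selfDualCompletion Γ) σ →+
      ∀ i : {i // p i}, ShareValue (selfDualCompletion Γ) σ (some i.1) :=
  AddMonoidHom.pi fun i => share (some i.1)

/-- What the players outside `S` and the environment hold. -/
def sharesOutside (Γ : Finset (Finset P)) (σ : Type) [AddCommGroup σ] (S : Finset P) :
    Codeword (selfDualCompletion Γ) σ →+
      (∀ i : {i // i ∉ S}, ShareValue (selfDualCompletion Γ) σ (some i.1)) ×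
        ShareValue (selfDualCompletion Γ) σ none :=
  (sharesOf Γ σ (· ∉ S)).prod (share none)

variable {S : Finset P}

theorem exists_sharesOf_eq_zero_and_secret_eq (hS : S ∉ Γ) (g : σ) :
    ∃ r, sharesOf Γ σ (· ∈ S) r = 0 ∧ secret r = g := by
  obtain ⟨r, hr, hg⟩ :=
    exists_share_eq_zero_and_secret_eq (mt map_some_mem_selfDualCompletion.mp hS) g
  exact ⟨r, funext fun i => hr _ (mem_map_of_mem _ i.2), hg⟩

theorem exists_sharesOutside_eq_zero_and_secret_eq (hint : (Γ : Set (Finset P)).Intersecting)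
    (hS : S ∈ Γ) (g : σ) : ∃ r, sharesOutside Γ σ S r = 0 ∧ secret r = g := by
  have hSc : insertNone Sᶜ ∉ selfDualCompletion Γ := fun h =>
    (insertNone_compl_mem_selfDualCompletion hint).mp h hS
  obtain ⟨r, hr, hg⟩ := exists_share_eq_zero_and_secret_eq hSc g
  exact ⟨r, Prod.ext (funext fun i => hr _ (by simpa using i.2)) (hr _ (by simp)), hg⟩

theorem injective_sharesOf (hup : IsUpperSet (Γ : Set (Finset P))) (hS : S ∈ Γ) :
    Injective (sharesOf Γ σ (· ∈ S)) := fun r r' h => by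
  refine eq_of_share_eq (isUpperSet_selfDualCompletion hup)
    (map_some_mem_selfDualCompletion.mpr hS) fun i hi => ?_
  obtain ⟨p, hp, rfl⟩ := mem_map.mp hi
  exact congrFun h ⟨p, hp⟩

theorem injective_sharesOutside (hup : IsUpperSet (Γ : Set (Finset P)))
    (hint : (Γ : Set (Finset P)).Intersecting) (hS : S ∉ Γ) :
    Injective (sharesOutside Γ σ S) := fun r r' h => by
  refine eq_of_share_eq (isUpperSet_selfDualCompletion hup)
    ((insertNone_compl_mem_selfDualCompletion hint).mpr hS) fun i hi => ?_
  obtain ⟨h₁, h₂⟩ := Prod.ext_iff.mp h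
  cases i with
  | none => exact h₂
  | some p => exact congrFun h₁ ⟨p, by simpa using hi⟩

variable [Fintype σ]

/-- Replicated quantum secret sharing for the self-dual completion of `Γ`, the share of the
additional player being discarded. -/
noncomputable abbrev sharing (σ : Type) [Fintype σ] [DecidableEq σ] [AddCommGroup σ]
    (hup : IsUpperSet (Γ : Set (Finset P))) (hint : (Γ : Set (Finset P)).Intersecting) :
    Encoding σ where
  Share := P
  Basis p := ShareValue (selfDualCompletion Γ) σ (some p)
  encode := traceOut (fun r p => share (some p) r) (share none) ∘ₗ superpose secret
  isChannel := by
    refine (isChannel_traceOut fun r r' h => ?_).comp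
      (isChannel_superpose (surjective_secret (empty_notMem_selfDualCompletion hint)))
    obtain ⟨h₁, h₂⟩ := Prod.ext_iff.mp h
    exact eq_of_share_eq (isUpperSet_selfDualCompletion hup) (univ_mem_selfDualCompletion hint)
      fun i _ => i.casesOn h₂ (congrFun h₁)

variable [DecidableEq σ] (hup : IsUpperSet (Γ : Set (Finset P)))
  (hint : (Γ : Set (Finset P)).Intersecting)

theorem shareChannel_sharing : (sharing σ hup hint).shareChannel S =
    traceOut (sharesOf Γ σ (· ∈ S)) (sharesOutside Γ σ S) ∘ₗ superpose secret := by
  rw [Encoding.shareChannel, ← LinearMap.comp_assoc, reducedMap, traceOut_comp]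
  rfl

theorem canRecover_sharing (hS : S ∈ Γ) : (sharing σ hup hint).CanRecover S := by
  have hinj := injective_sharesOf (σ := σ) hup hS
  rw [Encoding.canRecover_iff, shareChannel_sharing]
  exact exists_recovery_superpose (fun r r' h => hinj (Prod.ext_iff.mp h).1)
    (fun r hr => by rw [(map_eq_zero_iff _ hinj).mp hr, map_zero])
    (exists_sharesOutside_eq_zero_and_secret_eq hint hS)

theorem noInformation_sharing (hS : S ∉ Γ) : (sharing σ hup hint).NoInformation S := by
  have hinj := injective_sharesOutside (σ := σ) hup hint hS
  obtain ⟨ω, hω⟩ := exists_traceOut_superpose_eq_trace_smul (L := secret)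
    (a := sharesOf Γ σ (· ∈ S)) (fun r hr => by rw [(map_eq_zero_iff _ hinj).mp hr, map_zero])
    (exists_sharesOf_eq_zero_and_secret_eq hS)
  refine Encoding.noInformation_iff.mpr ⟨ω, fun ρ => ?_⟩
  rw [shareChannel_sharing]
  exact hω ρ

end Sharing

section Existence

variable {σ : Type} [Fintype σ] [Nonempty σ]

theorem nonempty_addCommGroup (σ : Type) [Finite σ] [Nonempty σ] : Nonempty (AddCommGroup σ) :=
  have : NeZero (Nat.card σ) := ⟨Nat.card_pos.ne'⟩
  ⟨(Finite.equivFin σ).addCommGroup⟩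

theorem exists_realizesConventionally {P : Type} [Finite P] [DecidableEq P] [Nonempty P]
    {Γ : Finset (Finset P)} (hup : IsUpperSet (Γ : Set (Finset P)))
    (hint : (Γ : Set (Finset P)).Intersecting) :
    ∃ 𝒮 : Scheme σ P, 𝒮.RealizesConventionally Γ := by
  classical
  have := Fintype.ofFinite P
  obtain ⟨_⟩ := nonempty_addCommGroup σ
  let 𝒮 : Scheme σ P := { sharing σ hup hint with owner := some }
  have havailable : ∀ A, 𝒮.available A = A := fun A => by
    ext p
    simp [Scheme.available, 𝒮]
  have hhome : 𝒮.homeCount = 0 := by simp [Scheme.homeCount, 𝒮]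
  refine ⟨𝒮, ⟨?_, fun A => ?_⟩, hhome⟩
  · rw [hhome]
    exact Fintype.card_pos (α := P)
  · rw [havailable]
    exact ⟨canRecover_sharing hup hint, noInformation_sharing hup hint⟩

theorem exists_isThreshold {k n : ℕ} (h : n < 2 * k) : ∃ T : Encoding σ, T.IsThreshold k n := by
  classical
  obtain ⟨_⟩ := nonempty_addCommGroup σ
  let Γ : Finset (Finset (Fin n)) := univ.filter fun S => k ≤ #S
  have hmem : ∀ {S}, S ∈ Γ ↔ k ≤ #S := by simp [Γ]
  have hup : IsUpperSet (Γ : Set (Finset (Fin n))) := fun S S' hS h =>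
    hmem.mpr ((hmem.mp h).trans (card_le_card hS))
  have hint : (Γ : Set (Finset (Fin n))).Intersecting := fun S hS S' hS' hdisj => by
    have hunion := card_finset_fin_le (S.disjUnion S' hdisj)
    rw [card_disjUnion] at hunion
    have := hmem.mp hS
    have := hmem.mp hS'
    omega
  exact ⟨sharing σ hup hint, Fintype.card_fin n, fun S =>
    ⟨fun hS => canRecover_sharing hup hint (hmem.mpr hS),
      fun hS => noInformation_sharing hup hint (mt hmem.mp hS.not_ge)⟩⟩

end Existence

/-! ### Partial link classifications -/

section Links

variable {α : Type*} [DecidableEq α] {s : Finset α} {𝒞 : Finpartition s}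

theorem exists_merge {C D : Finset α} (hC : C ∈ 𝒞.parts) (hD : D ∈ 𝒞.parts) (hCD : C ≠ D) :
    ∃ 𝒟 : Finpartition s, 𝒟.parts ⊆ insert (C ∪ D) 𝒞.parts ∧ #𝒟.parts < #𝒞.parts := by
  have hne : C ∪ D ≠ ∅ := ((𝒞.nonempty_of_mem_parts hC).mono subset_union_left).ne_empty
  have hothers : (𝒞.avoid (C ∪ D)).parts ⊆ (𝒞.parts.erase C).erase D := fun E hE => by
    obtain ⟨F, hF, hFle, rfl⟩ := 𝒞.mem_avoid.mp hE
    have hFC : F ≠ C := fun h => hFle (h ▸ subset_union_left)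
    have hFD : F ≠ D := fun h => hFle (h ▸ subset_union_right)
    have hdisj : Disjoint F (C ∪ D) :=
      disjoint_union_right.mpr ⟨𝒞.disjoint hF hC hFC, 𝒞.disjoint hF hD hFD⟩
    rw [sdiff_eq_self_of_disjoint hdisj]
    exact mem_erase.mpr ⟨hFD, mem_erase.mpr ⟨hFC, hF⟩⟩
  refine ⟨(𝒞.avoid (C ∪ D)).extend hne disjoint_sdiff_self_left
    (sdiff_union_of_subset (union_subset (𝒞.le hC) (𝒞.le hD))), ?_, ?_⟩
  · exact insert_subset_insert _ (hothers.trans ((erase_subset _ _).trans (erase_subset _ _)))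
  · have hcard := card_le_card hothers
    have hCcard := card_erase_add_one hC
    have hDcard := card_erase_add_one (mem_erase.mpr ⟨hCD.symm, hD⟩)
    rw [Finpartition.card_extend]
    omega

end Links

section Classes

variable {P : Type} [DecidableEq P] {Γ : Finset (Finset P)}

theorem exists_isPartialLinkClassification (hempty : ∅ ∉ Γ) :
    ∃ 𝒞 : Finpartition Γ, IsPartialLinkClassification 𝒞 := by
  let linked : Set (Finpartition Γ) :=
    {𝒞 | ∀ C ∈ 𝒞.parts, ∀ α ∈ C, ∀ β ∈ C, (α ∩ β).Nonempty}
  have hbot : ⊥ ∈ linked := fun C hC α hα β hβ => by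
    obtain ⟨γ, hγ, rfl⟩ := Finpartition.mem_bot_iff.mp hC
    rw [mem_singleton.mp hα, mem_singleton.mp hβ, inter_self]
    exact nonempty_iff_ne_empty.mpr fun h => hempty (h ▸ hγ)
  obtain ⟨𝒞, h𝒞, hmin⟩ := exists_minimalFor_of_wellFoundedLT (· ∈ linked)
    (fun 𝒞 => #𝒞.parts) ⟨⊥, hbot⟩
  refine ⟨𝒞, h𝒞, fun C hC D hD hCD => ?_⟩
  by_contra! hlink
  obtain ⟨𝒟, hsub, hcard⟩ := exists_merge hC hD hCD
  refine (hmin ?_ hcard.le).not_gt hcard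
  intro E hE α hα β hβ
  rcases mem_insert.mp (hsub hE) with rfl | hE
  · rcases mem_union.mp hα with hα | hα <;> rcases mem_union.mp hβ with hβ | hβ
    · exact h𝒞 C hC α hα β hβ
    · exact hlink α hα β hβ
    · rw [inter_comm]
      exact hlink β hβ α hα
    · exact h𝒞 D hD α hα β hβ
  · exact h𝒞 E hE α hα β hβ

theorem exists_card_eq_linkNumber (hempty : ∅ ∉ Γ) :
    ∃ 𝒞 : Finpartition Γ, IsPartialLinkClassification 𝒞 ∧ #𝒞.parts = linkNumber Γ := by
  obtain ⟨𝒞, h𝒞⟩ := exists_isPartialLinkClassification hempty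
  exact Nat.sInf_mem (s := {n | ∃ 𝒞 : Finpartition Γ, IsPartialLinkClassification 𝒞 ∧
    #𝒞.parts = n}) ⟨_, 𝒞, h𝒞, rfl⟩

theorem IsPartialLinkClassification.intersecting {𝒞 : Finpartition Γ}
    (h : IsPartialLinkClassification 𝒞) {C : Finset (Finset P)} (hC : C ∈ 𝒞.parts) :
    (C : Set (Finset P)).Intersecting := fun α hα β hβ =>
  not_disjoint_iff_nonempty_inter.mpr (h.1 C hC α hα β hβ)

variable [Fintype P] {C : Finset (Finset P)}

theorem mem_generated {A : Finset P} : A ∈ generated C ↔ ∃ α ∈ C, α ⊆ A := by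
  simp [generated]

theorem isUpperSet_generated : IsUpperSet (generated C : Set (Finset P)) := by
  intro A B hAB hA
  rw [mem_coe, mem_generated] at hA ⊢
  exact hA.imp fun α => And.imp_right fun hαA => hαA.trans hAB

theorem intersecting_generated (hC : (C : Set (Finset P)).Intersecting) :
    (generated C : Set (Finset P)).Intersecting := by
  intro A hA B hB hAB
  obtain ⟨α, hα, hαA⟩ := mem_generated.mp hA
  obtain ⟨β, hβ, hβB⟩ := mem_generated.mp hB
  exact hC hα hβ (hAB.mono hαA hβB)

theorem mem_iff_exists_mem_generated (hup : IsUpperSet (Γ : Set (Finset P)))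
    (𝒞 : Finpartition Γ) {A : Finset P} :
    A ∈ Γ ↔ ∃ C : {C // C ∈ 𝒞.parts}, A ∈ generated C.1 := by
  simp only [mem_generated, Subtype.exists, exists_prop]
  constructor
  · intro hA
    obtain ⟨C, hC, hAC⟩ := 𝒞.exists_mem hA
    exact ⟨C, hC, A, hAC, subset_rfl⟩
  · rintro ⟨C, hC, α, hα, hαA⟩
    exact hup hαA (𝒞.le hC hα)

end Classes

/-! ### The construction -/

section Construction

variable {σ P : Type} [Fintype σ] [Nonempty σ] [DecidableEq P] [Nonempty P]

theorem exists_realizesConventionally_and_keep [Finite P] (T : Encoding σ) {κ : Type}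
    {f : κ → T.Share} (hf : Injective f) {𝒢 : κ → Finset (Finset P)}
    (hup : ∀ c, IsUpperSet (𝒢 c : Set (Finset P)))
    (hint : ∀ c, (𝒢 c : Set (Finset P)).Intersecting) :
    ∃ Q : ∀ j : T.Share, Scheme (T.Basis j) P,
      (∀ c, (Q (f c)).RealizesConventionally (𝒢 c)) ∧
        ∀ j ∉ Set.range f, Q j = Scheme.keep (T.Basis j) P := by
  have hQ : ∀ j, ∃ Qj : Scheme (T.Basis j) P,
      (∀ c, f c = j → Qj.RealizesConventionally (𝒢 c)) ∧
        (j ∉ Set.range f → Qj = Scheme.keep (T.Basis j) P) := fun j => by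
    by_cases hj : j ∈ Set.range f
    · obtain ⟨c, rfl⟩ := hj
      obtain ⟨x⟩ := T.nonempty_basis
      have : Nonempty (T.Basis (f c)) := ⟨x (f c)⟩
      obtain ⟨Qc, hQc⟩ := exists_realizesConventionally (σ := T.Basis (f c)) (hup c) (hint c)
      exact ⟨Qc, fun c' hc' => hf hc' ▸ hQc, fun h => absurd (Set.mem_range_self c) h⟩
    · exact ⟨_, fun c hc => absurd ⟨c, hc⟩ hj, fun _ => rfl⟩
  choose Q hQf hQkeep using hQ
  exact ⟨Q, fun c => hQf _ c rfl, hQkeep⟩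

theorem exists_concat_realizes [Fintype P] {Γ : Finset (Finset P)} (hne : Γ.Nonempty)
    (hup : IsUpperSet (Γ : Set (Finset P))) (𝒞 : Finpartition Γ)
    (h𝒞 : ∀ C ∈ 𝒞.parts, (C : Set (Finset P)).Intersecting) :
    ∃ (T : Encoding σ) (f : {C // C ∈ 𝒞.parts} → T.Share)
      (Q : ∀ j : T.Share, Scheme (T.Basis j) P),
      T.IsThreshold #𝒞.parts (2 * #𝒞.parts - 1) ∧
      Injective f ∧
      (∀ C, (Q (f C)).RealizesConventionally (generated C.1)) ∧
      (∀ j, j ∉ Set.range f → Q j = Scheme.keep (T.Basis j) P) ∧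
      (Scheme.concat T Q).Realizes Γ ∧
      (Scheme.concat T Q).homeCount + 1 = #𝒞.parts := by
  obtain ⟨C, hC⟩ := 𝒞.parts_nonempty hne.ne_empty
  have hpos : 0 < #𝒞.parts := card_pos.mpr ⟨C, hC⟩
  have : Nonempty {C // C ∈ 𝒞.parts} := ⟨⟨C, hC⟩⟩
  have hclasses : Fintype.card {C // C ∈ 𝒞.parts} = #𝒞.parts := Fintype.card_coe _
  obtain ⟨T, hT⟩ := exists_isThreshold (σ := σ) (k := #𝒞.parts) (n := 2 * #𝒞.parts - 1) (by omega)
  obtain ⟨f⟩ : Nonempty ({C // C ∈ 𝒞.parts} ↪ T.Share) :=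
    Embedding.nonempty_of_card_le (by rw [hclasses, hT.1]; omega)
  obtain ⟨Q, hQ, hkeep⟩ := exists_realizesConventionally_and_keep T f.injective
    (fun C => isUpperSet_generated) fun C => intersecting_generated (h𝒞 C.1 C.2)
  have hhome := Scheme.homeCount_concat_add_card f.injective (fun C => (hQ C).2) hkeep
  rw [hclasses, hT.1] at hhome
  exact ⟨T, f, Q, hT, f.injective, hQ, hkeep, Scheme.concat_realizes hT (by omega) f.injective hQ
    hkeep fun A => mem_iff_exists_mem_generated hup 𝒞, by omega⟩

end Construction

end AQSS

theorem theorem1_general {σ P : Type} [Fintype σ] [Nontrivial σ] [Fintype P] [DecidableEq P]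
    {Γ : Finset (Finset P)} (hne : Γ.Nonempty) (hempty : ∅ ∉ Γ) :
    ((∃ 𝒮 : AQSS.Scheme σ P, 𝒮.Realizes Γ) ↔ ∀ A ∈ Γ, ∀ B : Finset P, A ⊆ B → B ∈ Γ) ∧
    ((∀ A ∈ Γ, ∀ B : Finset P, A ⊆ B → B ∈ Γ) →
      (∃ 𝒮 : AQSS.Scheme σ P, 𝒮.Realizes Γ ∧ 𝒮.homeCount + 1 ≤ AQSS.linkNumber Γ) ∧
      ∀ 𝒞 : Finpartition Γ, (∀ C ∈ 𝒞.parts, (C : Set (Finset P)).Intersecting) →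
        ∃ (T : AQSS.Encoding σ) (f : {C // C ∈ 𝒞.parts} → T.Share)
          (Q : ∀ j : T.Share, AQSS.Scheme (T.Basis j) P),
          T.IsThreshold 𝒞.parts.card (2 * 𝒞.parts.card - 1) ∧
          Function.Injective f ∧
          (∀ C, (Q (f C)).RealizesConventionally (AQSS.generated C.1)) ∧
          (∀ j, j ∉ Set.range f → Q j = AQSS.Scheme.keep (T.Basis j) P) ∧
          (AQSS.Scheme.concat T Q).Realizes Γ ∧
          (AQSS.Scheme.concat T Q).homeCount + 1 = 𝒞.parts.card) := by
  obtain ⟨A, hA⟩ := hne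
  obtain ⟨p, -⟩ : A.Nonempty := Finset.nonempty_iff_ne_empty.mpr fun h => hempty (h ▸ hA)
  have : Nonempty P := ⟨p⟩
  have hconcat := fun (hmono : ∀ A ∈ Γ, ∀ B : Finset P, A ⊆ B → B ∈ Γ) =>
    AQSS.exists_concat_realizes (σ := σ) ⟨A, hA⟩ fun A B hAB hA => hmono A hA B hAB
  obtain ⟨𝒞, h𝒞, hcard⟩ := AQSS.exists_card_eq_linkNumber hempty
  have hexists (hmono : ∀ A ∈ Γ, ∀ B : Finset P, A ⊆ B → B ∈ Γ) : ∃ 𝒮 : AQSS.Scheme σ P,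
      𝒮.Realizes Γ ∧ 𝒮.homeCount + 1 ≤ AQSS.linkNumber Γ := by
    obtain ⟨T, -, Q, -, -, -, -, hreal, hhome⟩ := hconcat hmono 𝒞 fun C hC => h𝒞.intersecting hC
    exact ⟨_, hreal, (hhome.trans hcard).le⟩
  exact ⟨⟨fun ⟨_, h𝒮⟩ A hA B hAB => h𝒮.isUpperSet hAB hA,
    fun hmono => (hexists hmono).imp fun _ => And.left⟩,
    fun hmono => ⟨hexists hmono, hconcat hmono⟩⟩

theorem theorem1 (N d : ℕ) (hd : 2 ≤ d) (Γ : Finset (Finset (Fin N)))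
    (hne : Γ.Nonempty) (hempty : ∅ ∉ Γ) :
    ((∃ 𝒮 : AQSS.Scheme (Fin d) (Fin N), 𝒮.Realizes Γ) ↔
      ∀ A ∈ Γ, ∀ B : Finset (Fin N), A ⊆ B → B ∈ Γ) ∧
    ((∀ A ∈ Γ, ∀ B : Finset (Fin N), A ⊆ B → B ∈ Γ) →
      (∃ 𝒮 : AQSS.Scheme (Fin d) (Fin N),
        𝒮.Realizes Γ ∧ 𝒮.homeCount + 1 ≤ AQSS.linkNumber Γ) ∧
      ∀ 𝒞 : Finpartition Γ, AQSS.IsPartialLinkClassification 𝒞 →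
        𝒞.parts.card = AQSS.linkNumber Γ →
        ∃ (T : AQSS.Encoding (Fin d))
          (f : {C // C ∈ 𝒞.parts} → T.Share)
          (Q : ∀ j : T.Share, AQSS.Scheme (T.Basis j) (Fin N)),
          T.IsThreshold (AQSS.linkNumber Γ) (2 * AQSS.linkNumber Γ - 1) ∧
          Function.Injective f ∧
          (∀ C, (Q (f C)).RealizesConventionally (AQSS.generated C.1)) ∧
          (∀ j, j ∉ Set.range f → Q j = AQSS.Scheme.keep (T.Basis j) (Fin N)) ∧
          (AQSS.Scheme.concat T Q).Realizes Γ ∧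
          (AQSS.Scheme.concat T Q).homeCount + 1 = AQSS.linkNumber Γ) := by
  have : Nontrivial (Fin d) := Fin.nontrivial_iff_two_le.mpr hd
  exact (theorem1_general hne hempty).imp_right fun h hmono => ⟨(h hmono).1,
    fun 𝒞 h𝒞 hcard => hcard ▸ (h hmono).2 𝒞 fun C hC => h𝒞.intersecting hC⟩
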